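/- Let $K\ge 1$ and let $p_1,\dots,p_K,q_1,\dots,q_K\ge 0$ satisfy $\sum_{k=1}^K p_k=\sum_{k=1}^K q_k=1$. The function $$C(u,v)=\prod_{k=1}^K\min(u^{p_k},v^{q_k}),\qquad (u,v)\in[0,1]^2,$$ is a copula (the comonotonic-based Liebscher copula). For a copula $C$, put $\beta(C)=4C(\tfrac12,\tfrac12)-1$ (Blomqvist's medial correlation coefficient), $\tau(C)=4\int_{[0,1]^2}C\,dC-1$ (Kendall's tau) and $\rho(C)=12\int_{[0,1]^2}C(u,v)\,du\,dv-3$ (Spearman's rho). Then $$\beta(C)=2^{\sum_{k=1}^K\min(p_k,q_k)}-1.$$ Suppose moreover that $(p_k,q_k)\ne(0,0)$ for all $k$, and that the pairs are numbered so that the ratios $r_k=p_k/q_k\in[0,\infty]$ are nondecreasing in $k$. With $\bar x_k=x_1+\dots+x_k$, $$\tau(C)=1-\sum_{k=1}^{K-1}\frac{(1-\bar p_k)\,\bar q_k\,(r_{k+1}-r_k)}{(\bar q_kr_k+(1-\bar p_k))(\bar q_kr_{k+1}+(1-\bar p_k))},$$ $$\rho(C)=\frac{12(1+r_1+r_1r_K)}{(2+r_1)(1+2r_K)}-3+12\sum_{k=1}^{K-1}\frac{r_{k+1}-r_k}{((1+\bar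 q_k)r_k+(2-\bar p_k))((1+\bar q_k)r_{k+1}+(2-\bar p_k))}.$$ When some ratios are infinite, each fraction is read after multiplying its numerator and denominator by $q_kq_{k+1}$ (by $q_1q_K$ for the first fraction in $\rho(C)$), so that $q_kr_k$ is replaced by $p_k$; for example $r_{k+1}-r_k$ becomes $p_{k+1}q_k-p_kq_{k+1}$. -/

import Mathlib

open scoped ENNReal

noncomputable section

/-- The closed unit square `[0,1]²`. -/
def unitSquare : Set (ℝ × ℝ) := Set.Icc 0 1 ×ˢ Set.Icc 0 1

/-- `μ` is the measure `dC` on `[0,1]²` of the bivariate distribution function `C`: a probability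
measure carried by `[0,1]²` with `μ ((-∞,u] × (-∞,v]) = C(u,v)` for `(u,v) ∈ [0,1]²`. -/
structure IsMeasureOf (C : ℝ → ℝ → ℝ) (μ : MeasureTheory.Measure (ℝ × ℝ)) : Prop where
  isProbabilityMeasure : MeasureTheory.IsProbabilityMeasure μ
  carried : μ unitSquareᶜ = 0
  cdf_eq : ∀ u ∈ Set.Icc (0 : ℝ) 1, ∀ v ∈ Set.Icc (0 : ℝ) 1,
    μ (Set.Iic u ×ˢ Set.Iic v) = ENNReal.ofReal (C u v)

/-- `C` is a bivariate copula: a distribution function on `[0,1]²` with uniform margins. -/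
def IsCopula (C : ℝ → ℝ → ℝ) : Prop :=
  (∃ μ, IsMeasureOf C μ) ∧ (∀ u ∈ Set.Icc (0 : ℝ) 1, C u 1 = u) ∧
    (∀ v ∈ Set.Icc (0 : ℝ) 1, C 1 v = v)

/-- A bivariate distribution function on `[0,1]²` determines its measure. -/
theorem IsMeasureOf.unique {C : ℝ → ℝ → ℝ} {μ ν : MeasureTheory.Measure (ℝ × ℝ)}
    (hμ : IsMeasureOf C μ) (hν : IsMeasureOf C ν) : μ = ν := by
  have := hμ.isProbabilityMeasure
  have := hν.isProbabilityMeasure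
  have key : ∀ (ρ : MeasureTheory.Measure (ℝ × ℝ)), IsMeasureOf C ρ → ∀ u v : ℝ,
      ρ (Set.Iic u ×ˢ Set.Iic v) =
        if 0 ≤ u ∧ 0 ≤ v then ENNReal.ofReal (C (min u 1) (min v 1)) else 0 := by
    intro ρ hρ u v
    split_ifs with h
    · rw [← hρ.cdf_eq (min u 1) ⟨le_min h.1 zero_le_one, min_le_right _ _⟩ (min v 1)
        ⟨le_min h.2 zero_le_one, min_le_right _ _⟩]
      apply MeasureTheory.measure_congr
      have h0 : ∀ᵐ z ∂ρ, z ∈ unitSquare := by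
        rw [MeasureTheory.ae_iff]; exact hρ.carried
      filter_upwards [h0] with z hz
      simp only [unitSquare, Set.mem_prod, Set.mem_Icc] at hz
      apply propext
      change (z ∈ Set.Iic u ×ˢ Set.Iic v) ↔ (z ∈ Set.Iic (min u 1) ×ˢ Set.Iic (min v 1))
      simp only [Set.mem_prod, Set.mem_Iic, le_min_iff]
      tauto
    · refine MeasureTheory.measure_mono_null ?_ hρ.carried
      intro z hz hz'
      simp only [unitSquare, Set.mem_prod, Set.mem_Icc, Set.mem_Iic] at hz hz'
      exact h ⟨by linarith, by linarith⟩
  have hspan : ∀ n : ℕ, (Set.Iic (n : ℝ)) ∈ Set.range (Set.Iic : ℝ → Set ℝ) := fun n => ⟨_, rfl⟩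
  have hcs : IsCountablySpanning (Set.range (Set.Iic : ℝ → Set ℝ)) := by
    refine ⟨fun n => Set.Iic (n : ℝ), hspan, ?_⟩
    ext x
    simpa using exists_nat_ge x
  have hgen : (inferInstance : MeasurableSpace (ℝ × ℝ)) = MeasurableSpace.generateFrom
      (Set.image2 (· ×ˢ ·) (Set.range (Set.Iic : ℝ → Set ℝ)) (Set.range Set.Iic)) := by
    refine (generateFrom_eq_prod ?_ ?_ hcs hcs).symm
    · rw [← borel_eq_generateFrom_Iic]; exact (BorelSpace.measurable_eq).symm
    · rw [← borel_eq_generateFrom_Iic]; exact (BorelSpace.measurable_eq).symm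
  refine MeasureTheory.ext_of_generate_finite _ hgen (isPiSystem_Iic.prod isPiSystem_Iic) ?_ ?_
  · rintro _ ⟨_, ⟨u, rfl⟩, _, ⟨v, rfl⟩, rfl⟩
    rw [key μ hμ, key ν hν]
  · simp

open Classical in
/-- The measure `dC` on `[0,1]²`; it is unique whenever it exists, as it does for copulas. -/
def measureOf (C : ℝ → ℝ → ℝ) : MeasureTheory.Measure (ℝ × ℝ) :=
  if h : ∃ μ, IsMeasureOf C μ then h.choose else 0

/-- Blomqvist's medial correlation coefficient `β(C) = 4 C(1/2, 1/2) - 1`. -/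
def blomqvistBeta (C : ℝ → ℝ → ℝ) : ℝ := 4 * C (1 / 2) (1 / 2) - 1

/-- Kendall's `τ(C) = 4 ∫_{[0,1]²} C(u,v) dC(u,v) - 1`. -/
def kendallTau (C : ℝ → ℝ → ℝ) : ℝ :=
  4 * (∫ z in unitSquare, C z.1 z.2 ∂(measureOf C)) - 1

/-- Spearman's `ρ(C) = 12 ∫_{[0,1]²} C(u,v) du dv - 3`. -/
def spearmanRho (C : ℝ → ℝ → ℝ) : ℝ :=
  12 * (∫ z in unitSquare, C z.1 z.2) - 3

/-- The comonotonic-based Liebscher copula `C(u,v) = ∏_{k=1}^K min(u^{p_k}, v^{q_k})`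
for `(u,v) ∈ [0,1]²`. -/
def liebscherCL (K : ℕ) (p q : ℕ → ℝ) (u v : ℝ) : ℝ :=
  ∏ k ∈ Finset.Icc 1 K, min (u ^ p k) (v ^ q k)

/-- The partial sum `x_1 + ⋯ + x_k`. -/
def partialSum (x : ℕ → ℝ) (k : ℕ) : ℝ := ∑ j ∈ Finset.Icc 1 k, x j

/-- The ratio `r_k = p_k / q_k ∈ [0,∞]`, equal to `∞` when `q_k = 0 < p_k`. -/
def ratio (p q : ℕ → ℝ) (k : ℕ) : ℝ≥0∞ := ENNReal.ofReal (p k) / ENNReal.ofReal (q k)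

end

/-! Each factor `min (u ^ p) (v ^ q)` is the distribution function of a comonotone pair: the
quantile functions of `u ^ p` and `v ^ q` applied to one uniform variable. A product of distribution
functions belongs to the componentwise maximum of independent pairs (`IsMeasureOf.mul`), so `dC`
exists; the margins are uniform because the exponents sum to one. The formula for β is arithmetic
with exponents of 2.

For τ, the singular measure `dC` is removed by integration by parts: ∫ C dC = 1/2 - ∬ D₁ D₂
(`IsMeasureOf.setIntegral_eq`). Both τ and ρ then become ordinary double integrals over the square.

These integrals are computed sector by sector. The curves v = u ^ r_k, called ridges, descend as k
grows. Together with the edges v = 1 (slope 0, index 0) and v = 0 (slope ∞, index K + 1) they cut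
the square into K + 1 sectors. Between ridges k + 1 and k, the factors with index at most k equal v
^ q_j and the others u ^ p_j, so C is the monomial u ^ (1 - p̄_k) * v ^ q̄_k. Integrating in v, then
along the bounding ridges in u, gives a difference of two fractions whose numerator contains p_{k+1}
q_k - p_k q_{k+1}. For τ the two outer sectors contribute zero, since q̄_0 = 0 and p̄_K = 1; for ρ
they add up to the separate first fraction. Working with pairs (p_k, q_k) rather than slopes treats
infinite ratios uniformly. -/

open MeasureTheory Set

/-! ### Existence of the measure `dC`. -/

/-- The product of two distribution functions is the distribution function of the pointwise
maximum of independent pairs. -/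
theorem IsMeasureOf.mul {C D : ℝ → ℝ → ℝ} {μ ν : Measure (ℝ × ℝ)}
    (hμ : IsMeasureOf C μ) (hν : IsMeasureOf D ν)
    (hC : ∀ u ∈ Icc (0 : ℝ) 1, ∀ v ∈ Icc (0 : ℝ) 1, 0 ≤ C u v) :
    IsMeasureOf (fun u v => C u v * D u v)
      ((μ.prod ν).map fun x : (ℝ × ℝ) × (ℝ × ℝ) => x.1 ⊔ x.2) := by
  have := hμ.isProbabilityMeasure
  have := hν.isProbabilityMeasure
  have hm : Measurable fun x : (ℝ × ℝ) × (ℝ × ℝ) => x.1 ⊔ x.2 :=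
    ((measurable_fst.comp measurable_fst).sup (measurable_fst.comp measurable_snd)).prodMk
      ((measurable_snd.comp measurable_fst).sup (measurable_snd.comp measurable_snd))
  have hS : MeasurableSet unitSquare := measurableSet_Icc.prod measurableSet_Icc
  refine ⟨Measure.isProbabilityMeasure_map hm.aemeasurable, ?_, ?_⟩
  · rw [Measure.map_apply hm hS.compl]
    refine measure_mono_null (t := (unitSquareᶜ ×ˢ univ) ∪ (univ ×ˢ unitSquareᶜ)) ?_ ?_
    · rintro ⟨⟨a, b⟩, ⟨c, d⟩⟩ h
      by_contra h'
      apply h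
      simp only [unitSquare, mem_union, mem_prod, mem_compl_iff, mem_univ, and_true, true_and,
        not_or, not_not, mem_Icc] at h' ⊢
      simp only [Prod.sup_def, le_sup_iff, sup_le_iff]
      tauto
    · refine measure_union_null ?_ ?_
      · rw [Measure.prod_prod, hμ.carried, zero_mul]
      · rw [Measure.prod_prod, hν.carried, mul_zero]
  · intro u hu v hv
    rw [Measure.map_apply hm (measurableSet_Iic.prod measurableSet_Iic),
      ENNReal.ofReal_mul (hC u hu v hv), ← hμ.cdf_eq u hu v hv, ← hν.cdf_eq u hu v hv,
      ← Measure.prod_prod]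
    congr 1
    ext ⟨⟨a, b⟩, ⟨c, d⟩⟩
    simp only [mem_preimage, mem_prod, mem_Iic, Prod.sup_def, sup_le_iff]
    tauto

/-- The quantile function of `u ↦ u ^ p` on `[0,1]`. -/
noncomputable def powQuantile (p x : ℝ) : ℝ := if p = 0 then 0 else x ^ p⁻¹

theorem measurable_powQuantile (p : ℝ) : Measurable (powQuantile p) := by
  unfold powQuantile
  split_ifs <;> fun_prop

theorem powQuantile_le_iff {p x u : ℝ} (hp : 0 ≤ p) (hx : x ∈ Ioc (0 : ℝ) 1)
    (hu : 0 ≤ u) : powQuantile p x ≤ u ↔ x ≤ u ^ p := by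
  unfold powQuantile
  split_ifs with h
  · simp [h, hu, hx.2]
  · exact Real.rpow_inv_le_iff_of_pos hx.1.le hu (lt_of_le_of_ne hp (Ne.symm h))

theorem powQuantile_mem_Icc {p x : ℝ} (hp : 0 ≤ p) (hx : x ∈ Ioc (0 : ℝ) 1) :
    powQuantile p x ∈ Icc (0 : ℝ) 1 := by
  refine ⟨?_, (powQuantile_le_iff hp hx zero_le_one).2 (by simpa using hx.2)⟩
  unfold powQuantile
  split_ifs
  · exact le_rfl
  · exact Real.rpow_nonneg hx.1.le _

/-- Both quantiles are driven by the same uniform `x`, so the event is `x ≤ u ^ p` and `x ≤ v ^ q`,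
an interval of length the minimum. For exponent 0 the quantile is constantly 0: the distribution
function `u ^ 0 = 1` is a unit mass at 0. -/
theorem isMeasureOf_min_rpow {p q : ℝ} (hp : 0 ≤ p) (hq : 0 ≤ q) :
    IsMeasureOf (fun u v => min (u ^ p) (v ^ q))
      ((volume.restrict (Ioc (0 : ℝ) 1)).map fun x => (powQuantile p x, powQuantile q x)) := by
  have hm : Measurable fun x => (powQuantile p x, powQuantile q x) :=
    (measurable_powQuantile p).prodMk (measurable_powQuantile q)
  have hprob : IsProbabilityMeasure (volume.restrict (Ioc (0 : ℝ) 1)) := ⟨by simp⟩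
  have hS : MeasurableSet unitSquare := measurableSet_Icc.prod measurableSet_Icc
  refine ⟨Measure.isProbabilityMeasure_map hm.aemeasurable, ?_, ?_⟩
  · rw [Measure.map_apply hm hS.compl, Measure.restrict_apply (hm hS.compl)]
    convert measure_empty (μ := (volume : Measure ℝ))
    refine eq_empty_of_forall_notMem fun x hx => hx.1 ?_
    exact mk_mem_prod (powQuantile_mem_Icc hp hx.2) (powQuantile_mem_Icc hq hx.2)
  · intro u hu v hv
    have hT : MeasurableSet (Iic u ×ˢ Iic v) := measurableSet_Iic.prod measurableSet_Iic
    rw [Measure.map_apply hm hT, Measure.restrict_apply (hm hT)]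
    have : (fun x => (powQuantile p x, powQuantile q x)) ⁻¹' (Iic u ×ˢ Iic v) ∩ Ioc 0 1
        = Ioc 0 (min (u ^ p) (v ^ q)) := by
      ext x
      simp only [mem_inter_iff, mem_preimage, mem_prod, mem_Iic]
      constructor
      · rintro ⟨⟨h1, h2⟩, hx⟩
        exact ⟨hx.1, le_min ((powQuantile_le_iff hp hx hu.1).1 h1)
          ((powQuantile_le_iff hq hx hv.1).1 h2)⟩
      · rintro ⟨h0, h⟩
        have hx : x ∈ Ioc (0 : ℝ) 1 :=
          ⟨h0, h.trans ((min_le_left _ _).trans (Real.rpow_le_one hu.1 hu.2 hp))⟩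
        rw [le_min_iff] at h
        exact ⟨⟨(powQuantile_le_iff hp hx hu.1).2 h.1, (powQuantile_le_iff hq hx hv.1).2 h.2⟩, hx⟩
    rw [this, Real.volume_Ioc, sub_zero]

theorem exists_isMeasureOf_prod_min_rpow {ι : Type*} (s : Finset ι) (p q : ι → ℝ)
    (hp : ∀ k ∈ s, 0 ≤ p k) (hq : ∀ k ∈ s, 0 ≤ q k) :
    ∃ μ, IsMeasureOf (fun u v => ∏ k ∈ s, min (u ^ p k) (v ^ q k)) μ := by
  classical
  induction s using Finset.induction_on with
  | empty =>
    refine ⟨Measure.dirac (0, 0), ⟨inferInstance, ?_, ?_⟩⟩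
    · have hS : MeasurableSet unitSquare := measurableSet_Icc.prod measurableSet_Icc
      rw [Measure.dirac_apply' _ hS.compl]
      simp [unitSquare]
    · intro u hu v hv
      rw [Measure.dirac_apply' _ (measurableSet_Iic.prod measurableSet_Iic)]
      simp [hu.1, hv.1]
  | insert a s ha ih =>
    obtain ⟨μ, hμ⟩ := ih (fun k hk => hp k (Finset.mem_insert_of_mem hk))
      (fun k hk => hq k (Finset.mem_insert_of_mem hk))
    have := (isMeasureOf_min_rpow (hp a (Finset.mem_insert_self _ _))
      (hq a (Finset.mem_insert_self _ _))).mul hμ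
      (fun u hu v hv => le_min (Real.rpow_nonneg hu.1 _) (Real.rpow_nonneg hv.1 _))
    simp_rw [Finset.prod_insert ha]
    exact ⟨_, this⟩

/-! ### Copula property and Blomqvist's beta. -/

section Liebscher

variable {K : ℕ} {p q : ℕ → ℝ}

theorem liebscherCL_swap (K : ℕ) (p q : ℕ → ℝ) (u v : ℝ) :
    liebscherCL K p q u v = liebscherCL K q p v u :=
  Finset.prod_congr rfl fun _ _ => min_comm _ _

theorem prod_rpow_eq_self (hp : ∀ k ∈ Finset.Icc 1 K, 0 ≤ p k)
    (hp1 : ∑ k ∈ Finset.Icc 1 K, p k = 1) {u : ℝ} (hu : 0 ≤ u) :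
    ∏ k ∈ Finset.Icc 1 K, u ^ p k = u := by
  rw [← Real.rpow_sum_of_nonneg hu hp, hp1, Real.rpow_one]

theorem liebscherCL_one_right (hp : ∀ k ∈ Finset.Icc 1 K, 0 ≤ p k)
    (hp1 : ∑ k ∈ Finset.Icc 1 K, p k = 1) {u : ℝ} (hu : u ∈ Icc (0 : ℝ) 1) :
    liebscherCL K p q u 1 = u := by
  rw [← prod_rpow_eq_self hp hp1 hu.1, liebscherCL]
  refine Finset.prod_congr rfl fun k hk => ?_
  -- The earlier rewrite also expanded the `u` inside each factor; this folds it back.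
  rw [prod_rpow_eq_self hp hp1 hu.1, Real.one_rpow]
  exact min_eq_left (Real.rpow_le_one hu.1 hu.2 (hp k hk))

theorem liebscherCL_nonneg {u v : ℝ} (hu : 0 ≤ u) (hv : 0 ≤ v) : 0 ≤ liebscherCL K p q u v :=
  Finset.prod_nonneg fun _ _ => le_min (Real.rpow_nonneg hu _) (Real.rpow_nonneg hv _)

theorem liebscherCL_le_left (hp : ∀ k ∈ Finset.Icc 1 K, 0 ≤ p k)
    (hp1 : ∑ k ∈ Finset.Icc 1 K, p k = 1) {u v : ℝ} (hu : 0 ≤ u) (hv : 0 ≤ v) :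
    liebscherCL K p q u v ≤ u := by
  conv_rhs => rw [← prod_rpow_eq_self hp hp1 hu]
  exact Finset.prod_le_prod
    (fun _ _ => le_min (Real.rpow_nonneg hu _) (Real.rpow_nonneg hv _)) fun _ _ => min_le_left _ _

theorem liebscherCL_zero_left (hp : ∀ k ∈ Finset.Icc 1 K, 0 ≤ p k)
    (hp1 : ∑ k ∈ Finset.Icc 1 K, p k = 1) {v : ℝ} (hv : 0 ≤ v) :
    liebscherCL K p q 0 v = 0 :=
  le_antisymm (liebscherCL_le_left hp hp1 le_rfl hv) (liebscherCL_nonneg le_rfl hv)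

theorem isMeasureOf_measureOf_liebscherCL (hp : ∀ k ∈ Finset.Icc 1 K, 0 ≤ p k)
    (hq : ∀ k ∈ Finset.Icc 1 K, 0 ≤ q k) :
    IsMeasureOf (liebscherCL K p q) (measureOf (liebscherCL K p q)) := by
  have h : ∃ μ, IsMeasureOf (liebscherCL K p q) μ := exists_isMeasureOf_prod_min_rpow _ p q hp hq
  rw [measureOf, dif_pos h]
  exact h.choose_spec

theorem isCopula_liebscherCL (hp : ∀ k ∈ Finset.Icc 1 K, 0 ≤ p k)
    (hq : ∀ k ∈ Finset.Icc 1 K, 0 ≤ q k) (hp1 : ∑ k ∈ Finset.Icc 1 K, p k = 1)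
    (hq1 : ∑ k ∈ Finset.Icc 1 K, q k = 1) : IsCopula (liebscherCL K p q) := by
  refine ⟨⟨_, isMeasureOf_measureOf_liebscherCL hp hq⟩, fun u hu =>
    liebscherCL_one_right hp hp1 hu, fun v hv => ?_⟩
  rw [liebscherCL_swap]
  exact liebscherCL_one_right hq hq1 hv

theorem blomqvistBeta_liebscherCL (hp1 : ∑ k ∈ Finset.Icc 1 K, p k = 1)
    (hq1 : ∑ k ∈ Finset.Icc 1 K, q k = 1) :
    blomqvistBeta (liebscherCL K p q)
      = (2 : ℝ) ^ (∑ k ∈ Finset.Icc 1 K, min (p k) (q k)) - 1 := by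
  -- At base 1/2 the minimum selects the larger exponent, and max x y = x + y - min x y. After
  -- summation the part -x - y contributes -2, which cancels 4 = 2 ^ 2.
  have h (x y : ℝ) : min ((1 / 2 : ℝ) ^ x) ((1 / 2 : ℝ) ^ y) = 2 ^ (min x y - x - y) := by
    have h2 (z : ℝ) : (1 / 2 : ℝ) ^ z = 2 ^ (-z) := by
      rw [one_div, Real.inv_rpow zero_le_two, Real.rpow_neg zero_le_two]
    rw [h2, h2, ← (Real.monotone_rpow_of_base_ge_one one_le_two).map_min]
    congr 1
    rcases le_total x y with hxy | hxy
    · rw [min_eq_left hxy, min_eq_right (neg_le_neg hxy)]; ring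
    · rw [min_eq_right hxy, min_eq_left (neg_le_neg hxy)]; ring
  have h4 : (4 : ℝ) = 2 ^ (2 : ℝ) := by norm_num
  simp only [blomqvistBeta, liebscherCL, h]
  rw [← Real.rpow_sum_of_pos two_pos, h4, ← Real.rpow_add two_pos, Finset.sum_sub_distrib,
    Finset.sum_sub_distrib, hp1, hq1]
  congr 2
  ring

end Liebscher

/-! ### Integration by parts for `∫ C dC`. -/

/-- For a copula `C` with bounded partial derivatives `D₁`, `D₂`, integration by parts gives
`∫ C dC = 1/2 - ∫∫ D₁ D₂`. -/
theorem IsMeasureOf.setIntegral_eq {C D₁ D₂ : ℝ → ℝ → ℝ} {μ : Measure (ℝ × ℝ)}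
    (hμ : IsMeasureOf C μ) (hC1 : ∀ u ∈ Icc (0 : ℝ) 1, C u 1 = u)
    (hC : Measurable (Function.uncurry C)) (h₁ : Measurable (Function.uncurry D₁))
    (h₂ : Measurable (Function.uncurry D₂))
    (hb₁ : ∀ u ∈ Ioc (0 : ℝ) 1, ∀ v ∈ Icc (0 : ℝ) 1, D₁ u v ∈ Icc (0 : ℝ) 1)
    (hb₂ : ∀ u ∈ Icc (0 : ℝ) 1, ∀ v ∈ Ioc (0 : ℝ) 1, D₂ u v ∈ Icc (0 : ℝ) 1)
    (hi₁ : ∀ u ∈ Icc (0 : ℝ) 1, ∀ v ∈ Icc (0 : ℝ) 1, ∫ t in (0 : ℝ)..u, D₁ t v = C u v)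
    (hi₂ : ∀ u ∈ Icc (0 : ℝ) 1, ∀ v ∈ Icc (0 : ℝ) 1, ∫ s in (0 : ℝ)..v, D₂ u s = C u v) :
    ∫ z in unitSquare, C z.1 z.2 ∂μ
      = 1 / 2 - ∫ u in (0 : ℝ)..1, ∫ v in (0 : ℝ)..1, D₁ u v * D₂ u v := by
  have := hμ.isProbabilityMeasure
  have hS : ∀ᵐ z ∂μ, z ∈ unitSquare := by
    rw [ae_iff]; exact hμ.carried
  have hμS : μ.restrict unitSquare = μ := Measure.restrict_eq_self_of_ae_mem hS
  have m₁ (v : ℝ) : Measurable fun t => D₁ t v := h₁.comp (measurable_id.prodMk measurable_const)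
  have m₂ (u : ℝ) : Measurable fun t => D₂ u t := h₂.comp (measurable_const.prodMk measurable_id)
  have int₁ : ∀ a ∈ Icc (0 : ℝ) 1, ∀ v ∈ Icc (0 : ℝ) 1,
      IntegrableOn (fun t => D₁ t v) (Ioc 0 a) := by
    intro a ha v hv
    refine Measure.integrableOn_of_bounded (M := 1) (by simp) (m₁ v).aestronglyMeasurable ?_
    filter_upwards [ae_restrict_mem measurableSet_Ioc] with t ht
    have := hb₁ t ⟨ht.1, ht.2.trans ha.2⟩ v hv
    rw [Real.norm_eq_abs, abs_of_nonneg this.1]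
    exact this.2
  have int₂ : ∀ a ∈ Icc (0 : ℝ) 1, ∀ u ∈ Icc (0 : ℝ) 1,
      IntegrableOn (fun t => D₂ u t) (Ioc 0 a) := by
    intro a ha u hu
    refine Measure.integrableOn_of_bounded (M := 1) (by simp) (m₂ u).aestronglyMeasurable ?_
    filter_upwards [ae_restrict_mem measurableSet_Ioc] with t ht
    have := hb₂ u hu t ⟨ht.1, ht.2.trans ha.2⟩
    rw [Real.norm_eq_abs, abs_of_nonneg this.1]
    exact this.2
  have hnn : ∀ u ∈ Icc (0 : ℝ) 1, ∀ v ∈ Icc (0 : ℝ) 1, 0 ≤ C u v := by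
    intro u hu v hv
    rw [← hi₂ u hu v hv]
    refine intervalIntegral.integral_nonneg_of_ae_restrict hv.1 ?_
    rw [← restrict_Ioc_eq_restrict_Icc]
    filter_upwards [ae_restrict_mem measurableSet_Ioc] with t ht
    exact (hb₂ u hu t ⟨ht.1, ht.2.trans hv.2⟩).1
  have hle : ∀ u ∈ Icc (0 : ℝ) 1, ∀ v ∈ Icc (0 : ℝ) 1,
      ∫⁻ t in Ioc 0 u, ENNReal.ofReal (1 - D₁ t v) = ENNReal.ofReal (u - C u v) := by
    intro u hu v hv
    have hone : Integrable (fun _ => (1 : ℝ)) (volume.restrict (Ioc 0 u)) := by simp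
    have hint : Integrable (fun t => 1 - D₁ t v) (volume.restrict (Ioc 0 u)) :=
      hone.sub (int₁ u hu v hv)
    rw [← ofReal_integral_eq_lintegral_ofReal hint]
    · rw [integral_sub hone (int₁ u hu v hv),
        ← intervalIntegral.integral_of_le hu.1, ← intervalIntegral.integral_of_le hu.1,
        hi₁ u hu v hv]
      simp
    · filter_upwards [ae_restrict_mem measurableSet_Ioc] with t ht
      exact sub_nonneg.2 (hb₁ t ⟨ht.1, ht.2.trans hu.2⟩ v hv).2
  set lam : Measure ℝ := volume.restrict (Ioc 0 1) with hlam
  -- The first margin of the part of `dC` above height `s`.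
  have marg : ∀ s ∈ Ioc (0 : ℝ) 1, (μ.restrict {z | s < z.2}).map Prod.fst
      = lam.withDensity fun u => ENNReal.ofReal (1 - D₁ u s) := by
    intro s hs
    have hs' : s ∈ Icc (0 : ℝ) 1 := ⟨hs.1.le, hs.2⟩
    have hms : MeasurableSet {z : ℝ × ℝ | s < z.2} := measurableSet_lt measurable_const measurable_snd
    have hmain : ∀ a ∈ Icc (0 : ℝ) 1,
        μ (Prod.fst ⁻¹' Iic a ∩ {z | s < z.2}) = ENNReal.ofReal (a - C a s) := by
      intro a ha
      have h1 : μ (Prod.fst ⁻¹' Iic a ∩ {z | s < z.2}) = μ ((Iic a ×ˢ Iic 1) \ (Iic a ×ˢ Iic s)) := by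
        apply measure_congr
        filter_upwards [hS] with z hz
        simp only [unitSquare, mem_prod, mem_Icc] at hz
        apply propext
        change (z ∈ Prod.fst ⁻¹' Iic a ∩ {z | s < z.2}) ↔
          (z ∈ (Iic a ×ˢ Iic (1 : ℝ)) \ (Iic a ×ˢ Iic s))
        simp only [mem_inter_iff, mem_preimage, mem_sdiff, mem_prod, mem_Iic, mem_ofPred_eq,
          ← not_le]
        tauto
      rw [h1, measure_sdiff (prod_mono_right (Iic_subset_Iic.2 hs.2))
        (measurableSet_Iic.prod measurableSet_Iic).nullMeasurableSet (measure_ne_top _ _),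
        hμ.cdf_eq a ha 1 ⟨zero_le_one, le_rfl⟩, hμ.cdf_eq a ha s hs', hC1 a ha,
        ENNReal.ofReal_sub _ (hnn a ha s hs')]
    -- Two finite measures on the line agree if their distribution functions do. Both are carried by
    -- [0,1], so the cases a < 0 and a > 1 reduce to trivial mass and to a = 1.
    refine Measure.ext_of_Iic _ _ fun a => ?_
    rw [Measure.map_apply measurable_fst measurableSet_Iic, Measure.restrict_apply
      (measurable_fst measurableSet_Iic), withDensity_apply _ measurableSet_Iic, hlam,
      Measure.restrict_restrict measurableSet_Iic]
    rcases lt_or_ge a 0 with ha | ha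
    · have h0 : Iic a ∩ Ioc (0 : ℝ) 1 = ∅ := by
        ext x
        simp only [mem_inter_iff, mem_Iic, mem_Ioc, mem_empty_iff_false, iff_false]
        intro h
        linarith [h.1, h.2.1]
      rw [h0, Measure.restrict_empty, lintegral_zero_measure]
      refine measure_mono_null ?_ hμ.carried
      intro z hz hz'
      simp only [unitSquare, mem_prod, mem_Icc, mem_inter_iff, mem_preimage, mem_Iic] at hz hz'
      linarith [hz.1, hz'.1.1]
    · rcases le_total a 1 with ha1 | ha1
      · have h0 : Iic a ∩ Ioc (0 : ℝ) 1 = Ioc 0 a := by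
          rw [inter_comm, Ioc_inter_Iic, min_eq_right ha1]
        rw [h0, hmain a ⟨ha, ha1⟩, hle a ⟨ha, ha1⟩ s hs']
      · have h0 : Iic a ∩ Ioc (0 : ℝ) 1 = Ioc 0 1 := by
          rw [inter_comm, Ioc_inter_Iic, min_eq_left ha1]
        rw [h0, hle 1 ⟨zero_le_one, le_rfl⟩ s hs', ← hmain 1 ⟨zero_le_one, le_rfl⟩]
        apply measure_congr
        filter_upwards [hS] with z hz
        simp only [unitSquare, mem_prod, mem_Icc] at hz
        apply propext
        change (z ∈ Prod.fst ⁻¹' Iic a ∩ {z | s < z.2}) ↔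
          (z ∈ Prod.fst ⁻¹' Iic 1 ∩ {z | s < z.2})
        simp only [mem_inter_iff, mem_preimage, mem_Iic, hz.1.2, hz.1.2.trans ha1]
  have hG : Measurable (Function.uncurry fun (z : ℝ × ℝ) (s : ℝ) =>
      {z : ℝ × ℝ | s < z.2}.indicator (fun z => ENNReal.ofReal (D₂ z.1 s)) z) := by
    have : (Function.uncurry fun (z : ℝ × ℝ) (s : ℝ) =>
      {z : ℝ × ℝ | s < z.2}.indicator (fun z => ENNReal.ofReal (D₂ z.1 s)) z)
      = {x : (ℝ × ℝ) × ℝ | x.2 < x.1.2}.indicator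
          (fun x => ENNReal.ofReal (Function.uncurry D₂ (x.1.1, x.2))) := rfl
    rw [this]
    refine Measurable.indicator ?_ (measurableSet_lt measurable_snd
      (measurable_snd.comp measurable_fst))
    exact (h₂.comp ((measurable_fst.comp measurable_fst).prodMk measurable_snd)).ennreal_ofReal
  -- C(u,v) is the integral of D₂(u,s) over 0 < s < v; writing the constraint as an indicator lets
  -- Tonelli exchange `s` with the `μ`-integral.
  have step1 : ∀ z ∈ unitSquare, ENNReal.ofReal (C z.1 z.2) = ∫⁻ s,
      {z : ℝ × ℝ | s < z.2}.indicator (fun z => ENNReal.ofReal (D₂ z.1 s)) z ∂lam := by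
    rintro ⟨u, v⟩ ⟨hu, hv⟩
    simp only at hu hv
    have e : (fun s => {z : ℝ × ℝ | s < z.2}.indicator (fun z => ENNReal.ofReal (D₂ z.1 s)) (u, v))
        = (Iio v).indicator fun s => ENNReal.ofReal (D₂ u s) := rfl
    have e2 : Iio v ∩ Ioc 0 1 = Ioo 0 v := by
      ext x
      simp only [mem_inter_iff, mem_Iio, mem_Ioc, mem_Ioo]
      exact ⟨fun h => ⟨h.2.1, h.1⟩, fun h => ⟨h.2, h.1, h.2.le.trans hv.2⟩⟩
    rw [e, lintegral_indicator measurableSet_Iio, hlam, Measure.restrict_restrict measurableSet_Iio,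
      e2, restrict_Ioo_eq_restrict_Ioc, ← ofReal_integral_eq_lintegral_ofReal (int₂ v hv u hu),
      ← intervalIntegral.integral_of_le hv.1, hi₂ u hu v hv]
    filter_upwards [ae_restrict_mem measurableSet_Ioc] with t ht
    exact (hb₂ u hu t ⟨ht.1, ht.2.trans hv.2⟩).1
  have mem_prod : ∀ᵐ x ∂lam.prod lam, x ∈ Ioc (0 : ℝ) 1 ×ˢ Ioc (0 : ℝ) 1 := by
    rw [hlam, Measure.prod_restrict]
    exact ae_restrict_mem (measurableSet_Ioc.prod measurableSet_Ioc)
  -- For fixed `s`, the inner integral over `s < z.2` depends on `z.1` only, so `marg` turns it into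
  -- an integral of D₂(u,s) (1 - D₁(u,s)) du.
  have step2 : ∫⁻ z, ENNReal.ofReal (C z.1 z.2) ∂μ
      = ∫⁻ x, ENNReal.ofReal (D₂ x.1 x.2 - D₁ x.1 x.2 * D₂ x.1 x.2) ∂lam.prod lam := by
    have hmD : Measurable fun x : ℝ × ℝ => ENNReal.ofReal (D₂ x.1 x.2 - D₁ x.1 x.2 * D₂ x.1 x.2) :=
      (h₂.sub (h₁.mul h₂)).ennreal_ofReal
    rw [lintegral_congr_ae (hS.mono step1), lintegral_lintegral_swap hG.aemeasurable,
      lintegral_prod_symm _ hmD.aemeasurable]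
    refine lintegral_congr_ae ?_
    filter_upwards [ae_restrict_mem measurableSet_Ioc] with s hs
    have hms : MeasurableSet {z : ℝ × ℝ | s < z.2} := measurableSet_lt measurable_const measurable_snd
    have hmu : Measurable fun u => ENNReal.ofReal (D₂ u s) :=
      (h₂.comp (measurable_id.prodMk measurable_const)).ennreal_ofReal
    have hm1 : Measurable fun u => ENNReal.ofReal (1 - D₁ u s) :=
      (measurable_const.sub (m₁ s)).ennreal_ofReal
    rw [lintegral_indicator hms, ← lintegral_map (f := fun u => ENNReal.ofReal (D₂ u s)) hmu
      measurable_fst, marg s hs, lintegral_withDensity_eq_lintegral_mul _ hm1 hmu]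
    refine lintegral_congr_ae ?_
    filter_upwards [ae_restrict_mem measurableSet_Ioc] with u hu
    rw [Pi.mul_apply, ← ENNReal.ofReal_mul (sub_nonneg.2 (hb₁ u hu s ⟨hs.1.le, hs.2⟩).2)]
    congr 1
    ring
  have bd : ∀ {f : ℝ × ℝ → ℝ}, Measurable f →
      (∀ x ∈ Ioc (0 : ℝ) 1 ×ˢ Ioc (0 : ℝ) 1, f x ∈ Icc (0 : ℝ) 1) →
      Integrable f (lam.prod lam) := by
    intro f hf h
    refine Integrable.of_bound hf.aestronglyMeasurable 1 ?_
    filter_upwards [mem_prod] with x hx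
    rw [Real.norm_eq_abs, abs_of_nonneg (h x hx).1]
    exact (h x hx).2
  have b₁ (x : ℝ × ℝ) (hx : x ∈ Ioc (0 : ℝ) 1 ×ˢ Ioc (0 : ℝ) 1) :=
    hb₁ x.1 hx.1 x.2 ⟨hx.2.1.le, hx.2.2⟩
  have b₂ (x : ℝ × ℝ) (hx : x ∈ Ioc (0 : ℝ) 1 ×ˢ Ioc (0 : ℝ) 1) :=
    hb₂ x.1 ⟨hx.1.1.le, hx.1.2⟩ x.2 hx.2
  have I₂ : Integrable (fun x : ℝ × ℝ => D₂ x.1 x.2) (lam.prod lam) := bd h₂ b₂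
  have I₁₂ : Integrable (fun x : ℝ × ℝ => D₁ x.1 x.2 * D₂ x.1 x.2) (lam.prod lam) :=
    bd (h₁.mul h₂) fun x hx => ⟨mul_nonneg (b₁ x hx).1 (b₂ x hx).1,
      mul_le_one₀ (b₁ x hx).2 (b₂ x hx).1 (b₂ x hx).2⟩
  have nn : 0 ≤ᵐ[lam.prod lam] fun x => D₂ x.1 x.2 - D₁ x.1 x.2 * D₂ x.1 x.2 := by
    filter_upwards [mem_prod] with x hx
    exact sub_nonneg.2 (mul_le_of_le_one_left (b₂ x hx).1 (b₁ x hx).2)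
  rw [hμS, integral_eq_lintegral_of_nonneg_ae, step2, ← integral_eq_lintegral_of_nonneg_ae nn
    (I₂.sub I₁₂).aestronglyMeasurable, integral_sub I₂ I₁₂, integral_prod _ I₂,
    integral_prod _ I₁₂]
  · have e : ∫ u, ∫ v, D₂ u v ∂lam ∂lam = 1 / 2 := by
      have : ∫ u, ∫ v, D₂ u v ∂lam ∂lam = ∫ u, u ∂lam := by
        refine integral_congr_ae ?_
        filter_upwards [ae_restrict_mem measurableSet_Ioc] with u hu
        have hu' : u ∈ Icc (0 : ℝ) 1 := ⟨hu.1.le, hu.2⟩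
        rw [hlam, ← intervalIntegral.integral_of_le zero_le_one,
          hi₂ u hu' 1 ⟨zero_le_one, le_rfl⟩, hC1 u hu']
      rw [this, hlam, ← intervalIntegral.integral_of_le zero_le_one, integral_id]
      norm_num
    rw [e, intervalIntegral.integral_of_le zero_le_one]
    simp_rw [intervalIntegral.integral_of_le (zero_le_one (α := ℝ))]
    rfl
  · filter_upwards [hS] with z hz
    exact hnn _ hz.1 _ hz.2
  · exact hC.aestronglyMeasurable

/-! ### Partial derivatives, and τ and ρ as double integrals. -/

/-- Partial derivative of `liebscherCL K p q` in the first variable, off the ridges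
`u ^ p k = v ^ q k`. -/
noncomputable def liebscherDeriv (K : ℕ) (p q : ℕ → ℝ) (u v : ℝ) : ℝ :=
  liebscherCL K p q u v * ((∑ k ∈ Finset.Icc 1 K, if u ^ p k < v ^ q k then p k else 0) / u)

/-- Off the kink the minimum is locally one of its two branches; for `p = 0` both are constant, so a
kink is harmless. The derivative is written as value times logarithmic derivative, so that the
product rule sums the logarithmic derivatives. -/
theorem hasDerivAt_min_rpow {p u c : ℝ} (hu : 0 < u) (h : p = 0 ∨ u ^ p ≠ c) :
    HasDerivAt (fun x => min (x ^ p) c) (min (u ^ p) c * ((if u ^ p < c then p else 0) / u)) u := by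
  rcases eq_or_ne p 0 with rfl | hp
  · simpa using hasDerivAt_const u (min 1 c)
  have hcont : ContinuousAt (fun x : ℝ => x ^ p) u :=
    Real.continuousAt_rpow_const _ _ (Or.inl hu.ne')
  rcases lt_or_gt_of_ne (h.resolve_left hp) with hlt | hlt
  · rw [if_pos hlt, min_eq_left hlt.le]
    have := (Real.hasDerivAt_rpow_const (p := p) (Or.inl hu.ne'))
    rw [Real.rpow_sub_one hu.ne'] at this
    refine (this.congr_of_eventuallyEq ?_).congr_deriv (by ring)
    filter_upwards [hcont.eventually_lt continuousAt_const hlt] with x hx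
    exact min_eq_left hx.le
  · rw [if_neg hlt.not_gt, zero_div, mul_zero]
    refine (hasDerivAt_const u c).congr_of_eventuallyEq ?_
    filter_upwards [continuousAt_const.eventually_lt hcont hlt] with x hx
    exact min_eq_right (le_of_lt hx)

section Liebscher

variable {K : ℕ} {p q : ℕ → ℝ}

theorem hasDerivAt_liebscherCL {u v : ℝ} (hu : 0 < u)
    (h : ∀ k ∈ Finset.Icc 1 K, p k = 0 ∨ u ^ p k ≠ v ^ q k) :
    HasDerivAt (fun x => liebscherCL K p q x v) (liebscherDeriv K p q u v) u := by
  classical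
  have := HasDerivAt.fun_finsetProd (u := Finset.Icc 1 K) fun k hk => hasDerivAt_min_rpow hu (h k hk)
  refine this.congr_deriv ?_
  rw [liebscherDeriv, Finset.sum_div, Finset.mul_sum]
  refine Finset.sum_congr rfl fun k hk => ?_
  rw [smul_eq_mul, ← mul_assoc, Finset.prod_erase_mul _ _ hk, liebscherCL]

theorem measurable_liebscherCL : Measurable (Function.uncurry (liebscherCL K p q)) := by
  unfold liebscherCL Function.uncurry
  exact Finset.measurable_fun_prod _ fun k _ =>
    (measurable_fst.pow_const _).min (measurable_snd.pow_const _)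

theorem measurable_liebscherDeriv : Measurable (Function.uncurry (liebscherDeriv K p q)) := by
  have h : Measurable fun x : ℝ × ℝ =>
      (∑ k ∈ Finset.Icc 1 K, if x.1 ^ p k < x.2 ^ q k then p k else 0) / x.1 := by
    refine Measurable.div (Finset.measurable_fun_sum _ fun k _ => ?_) measurable_fst
    exact Measurable.ite (measurableSet_lt (measurable_fst.pow_const _)
      (measurable_snd.pow_const _)) measurable_const measurable_const
  exact measurable_liebscherCL.mul h

theorem liebscherDeriv_mem_Icc (hp : ∀ k ∈ Finset.Icc 1 K, 0 ≤ p k)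
    (hp1 : ∑ k ∈ Finset.Icc 1 K, p k = 1) {u v : ℝ} (hu : 0 < u) (hv : 0 ≤ v) :
    liebscherDeriv K p q u v ∈ Icc (0 : ℝ) 1 := by
  have h0 : 0 ≤ ∑ k ∈ Finset.Icc 1 K, if u ^ p k < v ^ q k then p k else 0 :=
    Finset.sum_nonneg fun k hk => by split_ifs <;> [exact hp k hk; exact le_rfl]
  have h1 : ∑ k ∈ Finset.Icc 1 K, (if u ^ p k < v ^ q k then p k else 0) ≤ 1 := by
    rw [← hp1]
    exact Finset.sum_le_sum fun k hk => by split_ifs <;> [exact le_rfl; exact hp k hk]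
  refine ⟨mul_nonneg (liebscherCL_nonneg hu.le hv) (div_nonneg h0 hu.le), ?_⟩
  rw [liebscherDeriv, mul_div_assoc', div_le_one hu]
  exact (mul_le_of_le_one_right (liebscherCL_nonneg hu.le hv) h1).trans
    (liebscherCL_le_left hp hp1 hu.le hv)

/-- For fixed `v`, each factor with `p k ≠ 0` has at most one kink in `t > 0`, so the fundamental
theorem of calculus applies off a countable set. Integrability comes from the bound 0 ≤ D₁ ≤ C / u ≤
1. -/
theorem integral_liebscherDeriv (hp : ∀ k ∈ Finset.Icc 1 K, 0 ≤ p k)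
    (hp1 : ∑ k ∈ Finset.Icc 1 K, p k = 1) {u v : ℝ} (hu : u ∈ Icc (0 : ℝ) 1) (hv : 0 ≤ v) :
    ∫ t in (0 : ℝ)..u, liebscherDeriv K p q t v = liebscherCL K p q u v := by
  have hm : Measurable fun t => liebscherDeriv K p q t v :=
    measurable_liebscherDeriv.comp (measurable_id.prodMk measurable_const)
  set s : Set ℝ := ⋃ k ∈ Finset.Icc 1 K, {x | 0 < x ∧ p k ≠ 0 ∧ x ^ p k = v ^ q k}
  have hsc : s.Countable := by
    refine (Finset.Icc 1 K).countable_toSet.biUnion fun k _ => Subsingleton.countable ?_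
    rintro x ⟨hx, hpk, h⟩ y ⟨hy, -, h'⟩
    exact (Real.rpow_left_inj hx.le hy.le hpk).1 (h.trans h'.symm)
  rw [integral_eq_of_hasDerivAt_off_countable_of_le
    (fun x => liebscherCL K p q x v) _ hu.1 hsc, liebscherCL_zero_left hp hp1 hv, sub_zero]
  · refine Continuous.continuousOn ?_
    unfold liebscherCL
    exact continuous_finsetProd _ fun k hk =>
      (Real.continuous_rpow_const (hp k hk)).min continuous_const
  · rintro x ⟨hx, hxs⟩
    refine hasDerivAt_liebscherCL hx.1 fun k hk => ?_
    by_contra! h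
    exact hxs (mem_biUnion (t := fun k => {x | 0 < x ∧ p k ≠ 0 ∧ x ^ p k = v ^ q k}) hk
      ⟨hx.1, h.1, h.2⟩)
  · rw [intervalIntegrable_iff_integrableOn_Ioc_of_le hu.1]
    refine Measure.integrableOn_of_bounded (M := 1) (by simp) hm.aestronglyMeasurable ?_
    filter_upwards [ae_restrict_mem measurableSet_Ioc] with t ht
    have := liebscherDeriv_mem_Icc (q := q) hp hp1 ht.1 hv
    rw [Real.norm_eq_abs, abs_of_nonneg this.1]
    exact this.2

theorem kendallTau_liebscherCL_eq_integral (hp : ∀ k ∈ Finset.Icc 1 K, 0 ≤ p k)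
    (hq : ∀ k ∈ Finset.Icc 1 K, 0 ≤ q k) (hp1 : ∑ k ∈ Finset.Icc 1 K, p k = 1)
    (hq1 : ∑ k ∈ Finset.Icc 1 K, q k = 1) :
    kendallTau (liebscherCL K p q) = 1 - 4 * ∫ u in (0 : ℝ)..1, ∫ v in (0 : ℝ)..1,
      liebscherDeriv K p q u v * liebscherDeriv K q p v u := by
  rw [kendallTau, (isMeasureOf_measureOf_liebscherCL hp hq).setIntegral_eq
    (D₁ := liebscherDeriv K p q) (D₂ := fun u v => liebscherDeriv K q p v u)
    (fun u hu => liebscherCL_one_right hp hp1 hu) measurable_liebscherCL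
    measurable_liebscherDeriv (measurable_liebscherDeriv.comp measurable_swap)
    (fun u hu v hv => liebscherDeriv_mem_Icc hp hp1 hu.1 hv.1)
    (fun u hu v hv => liebscherDeriv_mem_Icc hq hq1 hv.1 hu.1)
    (fun u hu v hv => integral_liebscherDeriv hp hp1 hu hv.1)
    (fun u hu v hv => by
      rw [liebscherCL_swap]
      exact integral_liebscherDeriv hq hq1 hv hu.1)]
  ring

theorem spearmanRho_liebscherCL_eq_integral (hp : ∀ k ∈ Finset.Icc 1 K, 0 ≤ p k)
    (hp1 : ∑ k ∈ Finset.Icc 1 K, p k = 1) :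
    spearmanRho (liebscherCL K p q)
      = 12 * (∫ u in (0 : ℝ)..1, ∫ v in (0 : ℝ)..1, liebscherCL K p q u v) - 3 := by
  have hi : IntegrableOn (fun z : ℝ × ℝ => liebscherCL K p q z.1 z.2) unitSquare
      (volume.prod volume) := by
    refine Measure.integrableOn_of_bounded (M := 1) ?_
      measurable_liebscherCL.aestronglyMeasurable ?_
    · rw [unitSquare, Measure.prod_prod]; simp
    · filter_upwards [ae_restrict_mem (measurableSet_Icc.prod measurableSet_Icc)] with z hz
      rw [Real.norm_eq_abs, abs_of_nonneg (liebscherCL_nonneg hz.1.1 hz.2.1)]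
      exact (liebscherCL_le_left hp hp1 hz.1.1 hz.2.1).trans hz.1.2
  rw [spearmanRho, Measure.volume_eq_prod, unitSquare, setIntegral_prod _ hi,
    intervalIntegral.integral_of_le zero_le_one, integral_Icc_eq_integral_Ioc]
  simp_rw [intervalIntegral.integral_of_le (zero_le_one (α := ℝ)), integral_Icc_eq_integral_Ioc]

end Liebscher

/-! ### Ridges and integrals along them. -/

/-- The solution `v ∈ [0,1]` of `v ^ q = u ^ p`, where `u ^ ∞` is read as `0`. -/
noncomputable def ridge (p q u : ℝ) : ℝ := if q = 0 then 0 else u ^ (p / q)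

section Ridge

variable {p q p' q' u v c d : ℝ}

theorem ridge_nonneg (hu : 0 ≤ u) : 0 ≤ ridge p q u := by
  unfold ridge
  split_ifs
  · exact le_rfl
  · exact Real.rpow_nonneg hu _

theorem ridge_eq_inv_rpow (hu : 0 ≤ u) (hq : q ≠ 0) : ridge p q u = (u ^ p) ^ q⁻¹ := by
  rw [ridge, if_neg hq, div_eq_mul_inv, Real.rpow_mul hu]

theorem rpow_lt_of_lt_ridge (hq : 0 ≤ q) (hu : 0 < u) (hv : 0 < v) (h : v < ridge p q u) :
    v ^ q < u ^ p := by
  rcases hq.eq_or_lt' with h0 | h0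
  · rw [ridge, if_pos h0] at h
    exact absurd h hv.le.not_gt
  · rw [ridge_eq_inv_rpow hu.le h0.ne',
      Real.lt_rpow_inv_iff_of_pos hv.le (Real.rpow_nonneg hu.le _) h0] at h
    exact h

theorem lt_rpow_of_ridge_lt (hp : 0 ≤ p) (hq : 0 ≤ q) (hpq : ¬(p = 0 ∧ q = 0)) (hu : 0 < u)
    (hu1 : u < 1) (hv : 0 < v) (h : ridge p q u < v) : u ^ p < v ^ q := by
  rcases hq.eq_or_lt' with h0 | h0
  · rw [h0, Real.rpow_zero]
    exact Real.rpow_lt_one hu.le hu1 (hp.lt_of_ne fun h => hpq ⟨h.symm, h0⟩)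
  · rwa [ridge_eq_inv_rpow hu.le h0.ne',
      Real.rpow_inv_lt_iff_of_pos (Real.rpow_nonneg hu.le _) hv.le h0] at h

theorem ridge_le_ridge (hp : 0 ≤ p) (hq : 0 ≤ q) (hpq : ¬(p = 0 ∧ q = 0)) (hq' : 0 ≤ q')
    (h : p * q' ≤ p' * q) (hu : 0 < u) (hu1 : u ≤ 1) : ridge p' q' u ≤ ridge p q u := by
  rcases hq'.eq_or_lt' with h0' | h0'
  · rw [ridge, if_pos h0']
    exact ridge_nonneg hu.le
  · rcases hq.eq_or_lt' with h0 | h0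
    · have hp0 : 0 < p := hp.lt_of_ne fun h => hpq ⟨h.symm, h0⟩
      rw [h0, mul_zero] at h
      exact absurd h (mul_pos hp0 h0').not_ge
    · rw [ridge, ridge, if_neg h0'.ne', if_neg h0.ne']
      exact Real.rpow_le_rpow_of_exponent_ge hu hu1 ((div_le_div_iff₀ h0 h0').2 h)

/-- For `q ≠ 0` the integrand is the single power u ^ (c + d p / q) on (0,1). For `q = 0` the ridge
is 0 and both sides vanish; this needs `d ≠ 0`, because 0 ^ 0 = 1. -/
theorem intervalIntegrable_and_integral_rpow_mul_ridge_rpow (hp : 0 ≤ p) (hq : 0 ≤ q)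
    (hc : -1 < c) (hd : 0 < d) :
    IntervalIntegrable (fun u => u ^ c * ridge p q u ^ d) volume 0 1 ∧
      ∫ u in (0 : ℝ)..1, u ^ c * ridge p q u ^ d = q / ((c + 1) * q + d * p) := by
  rcases hq.eq_or_lt' with h0 | h0
  · simp [ridge, h0, Real.zero_rpow hd.ne']
  · have he : -1 < c + p / q * d := by
      have := mul_nonneg (div_nonneg hp hq) hd.le
      linarith
    have heq : EqOn (fun u : ℝ => u ^ (c + p / q * d)) (fun u => u ^ c * ridge p q u ^ d)
        (Ioo 0 1) := by
      intro u hu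
      simp only [ridge, if_neg h0.ne']
      rw [← Real.rpow_mul hu.1.le, ← Real.rpow_add hu.1]
    refine ⟨(intervalIntegral.intervalIntegrable_rpow' he).congr_uIoo
      (by rwa [uIoo_of_le zero_le_one]), ?_⟩
    rw [← intervalIntegral.integral_congr_Ioo_of_le zero_le_one heq, integral_rpow (Or.inl he),
      Real.one_rpow, Real.zero_rpow (by linarith), sub_zero]
    have h1 : c + p / q * d + 1 = ((c + 1) * q + d * p) / q := by field_simp; ring
    rw [h1, one_div_div]

end Ridge

/-- Agreement is required only on open steps, so the values on the ridges never matter. -/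
theorem integral_eq_sum_of_antitone_steps {t : ℕ → ℝ} {n : ℕ} {f : ℝ → ℝ} {g : ℕ → ℝ → ℝ}
    (ht : ∀ k < n, t (k + 1) ≤ t k) (hfg : ∀ k < n, EqOn (g k) f (Ioo (t (k + 1)) (t k)))
    (hg : ∀ k < n, IntervalIntegrable (g k) volume (t (k + 1)) (t k)) :
    ∫ v in t n..t 0, f v = ∑ k ∈ Finset.range n, ∫ v in t (k + 1)..t k, g k v := by
  have hf : ∀ k < n, IntervalIntegrable f volume (t k) (t (k + 1)) := fun k hk =>
    ((hg k hk).congr_uIoo (by rw [uIoo_of_le (ht k hk)]; exact hfg k hk)).symm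
  rw [intervalIntegral.integral_symm, ← intervalIntegral.sum_integral_adjacent_intervals hf,
    ← Finset.sum_neg_distrib]
  refine Finset.sum_congr rfl fun k hk => ?_
  have hk := Finset.mem_range.1 hk
  rw [← intervalIntegral.integral_symm,
    intervalIntegral.integral_congr_Ioo_of_le (ht k hk) (hfg k hk)]

theorem sum_ite_le_eq_partialSum {K k : ℕ} (hk : k ≤ K) (x : ℕ → ℝ) :
    (∑ j ∈ Finset.Icc 1 K, if j ≤ k then x j else 0) = partialSum x k := by
  rw [← Finset.sum_filter, partialSum]
  congr 1
  ext j
  simp only [Finset.mem_filter, Finset.mem_Icc]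
  omega

theorem sum_ite_le_eq_sub_partialSum {K k : ℕ} (hk : k ≤ K) (x : ℕ → ℝ) :
    (∑ j ∈ Finset.Icc 1 K, if j ≤ k then 0 else x j)
      = ∑ j ∈ Finset.Icc 1 K, x j - partialSum x k := by
  rw [← sum_ite_le_eq_partialSum hk, ← Finset.sum_sub_distrib]
  exact Finset.sum_congr rfl fun j _ => by split_ifs <;> simp

/-! ### Sectors between consecutive ridges. -/

/-- The pairs `(p k, q k)`, `1 ≤ k ≤ K`, are sorted by slope, and are completed by
`(p 0, q 0) = (0, 1)` and `(p (K + 1), q (K + 1)) = (1, 0)`. -/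
structure IsSlopeOrdered (K : ℕ) (p q : ℕ → ℝ) : Prop where
  left_nonneg : ∀ k ≤ K + 1, 0 ≤ p k
  right_nonneg : ∀ k ≤ K + 1, 0 ≤ q k
  ne_zero : ∀ k ≤ K + 1, ¬(p k = 0 ∧ q k = 0)
  mul_le_mul : ∀ i j, i ≤ j → j ≤ K + 1 → p i * q j ≤ p j * q i
  left_first : p 0 = 0
  right_first : q 0 = 1
  left_last : p (K + 1) = 1
  right_last : q (K + 1) = 0
  sum_left : ∑ k ∈ Finset.Icc 1 K, p k = 1
  sum_right : ∑ k ∈ Finset.Icc 1 K, q k = 1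

namespace IsSlopeOrdered

variable {K k : ℕ} {p q : ℕ → ℝ} {u v : ℝ}

theorem partialSum_left_le_one (h : IsSlopeOrdered K p q) (hk : k ≤ K) : partialSum p k ≤ 1 := by
  rw [← h.sum_left]
  refine Finset.sum_le_sum_of_subset_of_nonneg (Finset.Icc_subset_Icc_right hk) fun j hj _ => ?_
  exact h.left_nonneg j (by rw [Finset.mem_Icc] at hj; omega)

theorem partialSum_right_nonneg (h : IsSlopeOrdered K p q) (hk : k ≤ K) : 0 ≤ partialSum q k :=
  Finset.sum_nonneg fun j hj => h.right_nonneg j (by rw [Finset.mem_Icc] at hj; omega)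

theorem one_le (h : IsSlopeOrdered K p q) : 1 ≤ K := by
  by_contra hK
  have := h.sum_left
  simp [Nat.lt_one_iff.1 (not_le.1 hK)] at this

theorem ridge_antitone (h : IsSlopeOrdered K p q) {i j : ℕ} (hij : i ≤ j) (hj : j ≤ K + 1)
    (hu : 0 < u) (hu1 : u ≤ 1) : ridge (p j) (q j) u ≤ ridge (p i) (q i) u :=
  ridge_le_ridge (h.left_nonneg i (hij.trans hj)) (h.right_nonneg i (hij.trans hj))
    (h.ne_zero i (hij.trans hj)) (h.right_nonneg j hj) (h.mul_le_mul i j hij hj) hu hu1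

theorem rpow_lt_of_mem_sector (h : IsSlopeOrdered K p q) (hk : k ≤ K) (hu : u ∈ Ioo (0 : ℝ) 1)
    (hv : v ∈ Ioo (ridge (p (k + 1)) (q (k + 1)) u) (ridge (p k) (q k) u)) {j : ℕ}
    (hj : j ≤ k) : v ^ q j < u ^ p j :=
  rpow_lt_of_lt_ridge (h.right_nonneg j (by omega)) hu.1 ((ridge_nonneg hu.1.le).trans_lt hv.1)
    (hv.2.trans_le (h.ridge_antitone hj (by omega) hu.1 hu.2.le))

theorem lt_rpow_of_mem_sector (h : IsSlopeOrdered K p q) (hu : u ∈ Ioo (0 : ℝ) 1)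
    (hv : v ∈ Ioo (ridge (p (k + 1)) (q (k + 1)) u) (ridge (p k) (q k) u)) {j : ℕ}
    (hj : k < j) (hjK : j ≤ K) : u ^ p j < v ^ q j :=
  lt_rpow_of_ridge_lt (h.left_nonneg j (by omega)) (h.right_nonneg j (by omega))
    (h.ne_zero j (by omega)) hu.1 hu.2 ((ridge_nonneg hu.1.le).trans_lt hv.1)
    ((h.ridge_antitone (show k + 1 ≤ j from hj) (by omega) hu.1 hu.2.le).trans_lt hv.1)

/-- The point lies below ridges 0, …, k and above the rest, which decides every minimum: the first k
factors contribute powers of `v`, the others powers of `u`. -/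
theorem liebscherCL_of_mem_sector (h : IsSlopeOrdered K p q) (hk : k ≤ K)
    (hu : u ∈ Ioo (0 : ℝ) 1)
    (hv : v ∈ Ioo (ridge (p (k + 1)) (q (k + 1)) u) (ridge (p k) (q k) u)) :
    liebscherCL K p q u v = u ^ (1 - partialSum p k) * v ^ partialSum q k := by
  have hv0 : 0 < v := (ridge_nonneg hu.1.le).trans_lt hv.1
  rw [← sum_ite_le_eq_partialSum hk q, ← h.sum_left, ← sum_ite_le_eq_sub_partialSum hk p,
    Real.rpow_sum_of_pos hu.1, Real.rpow_sum_of_pos hv0, ← Finset.prod_mul_distrib, liebscherCL]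
  refine Finset.prod_congr rfl fun j hj => ?_
  split_ifs with hjk
  · rw [Real.rpow_zero, one_mul]
    exact min_eq_right (h.rpow_lt_of_mem_sector hk hu hv hjk).le
  · rw [Real.rpow_zero, mul_one]
    exact min_eq_left
      (h.lt_rpow_of_mem_sector hu hv (not_le.1 hjk) (Finset.mem_Icc.1 hj).2).le

theorem liebscherDeriv_left_of_mem_sector (h : IsSlopeOrdered K p q) (hk : k ≤ K)
    (hu : u ∈ Ioo (0 : ℝ) 1)
    (hv : v ∈ Ioo (ridge (p (k + 1)) (q (k + 1)) u) (ridge (p k) (q k) u)) :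
    liebscherDeriv K p q u v
      = u ^ (1 - partialSum p k) * v ^ partialSum q k * ((1 - partialSum p k) / u) := by
  rw [liebscherDeriv, h.liebscherCL_of_mem_sector hk hu hv, ← h.sum_left,
    ← sum_ite_le_eq_sub_partialSum hk p]
  congr 2
  refine Finset.sum_congr rfl fun j hj => ?_
  by_cases hjk : j ≤ k
  · rw [if_pos hjk, if_neg (h.rpow_lt_of_mem_sector hk hu hv hjk).not_gt]
  · rw [if_neg hjk,
      if_pos (h.lt_rpow_of_mem_sector hu hv (not_le.1 hjk) (Finset.mem_Icc.1 hj).2)]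

theorem liebscherDeriv_right_of_mem_sector (h : IsSlopeOrdered K p q) (hk : k ≤ K)
    (hu : u ∈ Ioo (0 : ℝ) 1)
    (hv : v ∈ Ioo (ridge (p (k + 1)) (q (k + 1)) u) (ridge (p k) (q k) u)) :
    liebscherDeriv K q p v u
      = u ^ (1 - partialSum p k) * v ^ partialSum q k * (partialSum q k / v) := by
  rw [liebscherDeriv, liebscherCL_swap, h.liebscherCL_of_mem_sector hk hu hv,
    ← sum_ite_le_eq_partialSum hk q]
  congr 2
  refine Finset.sum_congr rfl fun j hj => ?_
  by_cases hjk : j ≤ k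
  · rw [if_pos hjk, if_pos (h.rpow_lt_of_mem_sector hk hu hv hjk)]
  · rw [if_neg hjk,
      if_neg (h.lt_rpow_of_mem_sector hu hv (not_le.1 hjk) (Finset.mem_Icc.1 hj).2).not_gt]

/-- The added pairs (0,1) and (1,0) have ridges 1 and 0, so the sectors fill the whole interval. -/
theorem integral_eq_sum_sectors (h : IsSlopeOrdered K p q) (hu : u ∈ Ioo (0 : ℝ) 1)
    {f : ℝ → ℝ} {g : ℕ → ℝ → ℝ}
    (hfg : ∀ k ≤ K, EqOn (g k) f (Ioo (ridge (p (k + 1)) (q (k + 1)) u) (ridge (p k) (q k) u)))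
    (hg : ∀ k ≤ K, IntervalIntegrable (g k) volume (ridge (p (k + 1)) (q (k + 1)) u)
      (ridge (p k) (q k) u)) :
    ∫ v in (0 : ℝ)..1, f v = ∑ k ∈ Finset.range (K + 1),
      ∫ v in ridge (p (k + 1)) (q (k + 1)) u..ridge (p k) (q k) u, g k v := by
  have h0 : ridge (p 0) (q 0) u = 1 := by simp [ridge, h.left_first, h.right_first]
  have h1 : ridge (p (K + 1)) (q (K + 1)) u = 0 := by simp [ridge, h.right_last]
  rw [← integral_eq_sum_of_antitone_steps (t := fun k => ridge (p k) (q k) u) (f := f)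
    (fun k hk => h.ridge_antitone (Nat.le_succ k) hk hu.1 hu.2.le)
    (fun k hk => hfg k (Nat.le_of_lt_succ hk)) (fun k hk => hg k (Nat.le_of_lt_succ hk)), h0, h1]

theorem denom_pos (h : IsSlopeOrdered K p q) (hk : k ≤ K + 1) {a b : ℝ} (ha : 0 < a) (hb : 0 < b) :
    0 < a * q k + b * p k := by
  have hp := h.left_nonneg k hk
  have hq := h.right_nonneg k hk
  rcases hq.eq_or_lt' with h0 | h0
  · have : 0 < p k := hp.lt_of_ne fun h' => h.ne_zero k hk ⟨h'.symm, h0⟩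
    positivity
  · positivity

theorem integral_liebscherCL (h : IsSlopeOrdered K p q) :
    ∫ u in (0 : ℝ)..1, ∫ v in (0 : ℝ)..1, liebscherCL K p q u v
      = ∑ k ∈ Finset.range (K + 1), (p (k + 1) * q k - p k * q (k + 1)) /
          (((1 + partialSum q k) * p k + (2 - partialSum p k) * q k) *
            ((1 + partialSum q k) * p (k + 1) + (2 - partialSum p k) * q (k + 1))) := by
  have inner : EqOn (fun u => ∫ v in (0 : ℝ)..1, liebscherCL K p q u v)
      (fun u => ∑ k ∈ Finset.range (K + 1), (partialSum q k + 1)⁻¹ *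
        (u ^ (1 - partialSum p k) * ridge (p k) (q k) u ^ (partialSum q k + 1) -
          u ^ (1 - partialSum p k) * ridge (p (k + 1)) (q (k + 1)) u ^ (partialSum q k + 1)))
      (Ioo 0 1) := by
    intro u hu
    simp only
    have hb (k : ℕ) (hk : k ≤ K) : -1 < partialSum q k := by
      linarith [h.partialSum_right_nonneg hk]
    rw [h.integral_eq_sum_sectors hu
      (g := fun k v => u ^ (1 - partialSum p k) * v ^ partialSum q k)
      (fun k hk v hv => (h.liebscherCL_of_mem_sector hk hu hv).symm)
      (fun k hk => (intervalIntegral.intervalIntegrable_rpow' (hb k hk)).const_mul _)]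
    refine Finset.sum_congr rfl fun k hk => ?_
    rw [intervalIntegral.integral_const_mul,
      integral_rpow (Or.inl (hb k (Nat.le_of_lt_succ (Finset.mem_range.1 hk))))]
    ring
  have key (k : ℕ) (hk : k ≤ K) (j : ℕ) (hj : j ≤ K + 1) :=
    intervalIntegrable_and_integral_rpow_mul_ridge_rpow (h.left_nonneg j hj) (h.right_nonneg j hj)
      (c := 1 - partialSum p k) (d := partialSum q k + 1)
      (by linarith [h.partialSum_left_le_one hk]) (by linarith [h.partialSum_right_nonneg hk])
  rw [intervalIntegral.integral_congr_Ioo_of_le zero_le_one inner,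
    intervalIntegral.integral_finsetSum]
  · refine Finset.sum_congr rfl fun k hk => ?_
    have hk : k ≤ K := Nat.le_of_lt_succ (Finset.mem_range.1 hk)
    have hb := h.partialSum_right_nonneg hk
    have ha := h.partialSum_left_le_one hk
    have k1 := key k hk k (by omega)
    have k2 := key k hk (k + 1) (by omega)
    rw [intervalIntegral.integral_const_mul, intervalIntegral.integral_sub k1.1 k2.1, k1.2, k2.2]
    have d1 := h.denom_pos (k := k) (by omega) (a := 2 - partialSum p k)
      (b := 1 + partialSum q k) (by linarith) (by linarith)
    have d2 := h.denom_pos (k := k + 1) (by omega) (a := 2 - partialSum p k)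
      (b := 1 + partialSum q k) (by linarith) (by linarith)
    have e (j : ℕ) : (1 - partialSum p k + 1) * q j + (partialSum q k + 1) * p j
        = (2 - partialSum p k) * q j + (1 + partialSum q k) * p j := by ring
    have hb' : partialSum q k + 1 ≠ 0 := by positivity
    rw [e, e, add_comm ((1 + partialSum q k) * p k), add_comm ((1 + partialSum q k) * p (k + 1)),
      div_sub_div _ _ d1.ne' d2.ne', mul_div_assoc', div_left_inj' (mul_pos d1 d2).ne',
      inv_mul_eq_iff_eq_mul₀ hb']
    ring
  · intro k hk
    have hk : k ≤ K := Nat.le_of_lt_succ (Finset.mem_range.1 hk)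
    exact ((key k hk k (by omega)).1.sub (key k hk (k + 1) (by omega)).1).const_mul _

theorem integral_liebscherDeriv_mul (h : IsSlopeOrdered K p q) :
    4 * ∫ u in (0 : ℝ)..1, ∫ v in (0 : ℝ)..1, liebscherDeriv K p q u v * liebscherDeriv K q p v u
      = ∑ k ∈ Finset.range (K + 1),
          (1 - partialSum p k) * partialSum q k * (p (k + 1) * q k - p k * q (k + 1)) /
            ((partialSum q k * p k + (1 - partialSum p k) * q k) *
              (partialSum q k * p (k + 1) + (1 - partialSum p k) * q (k + 1))) := by
  have inner : EqOn
      (fun u => ∫ v in (0 : ℝ)..1, liebscherDeriv K p q u v * liebscherDeriv K q p v u)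
      (fun u => ∑ k ∈ Finset.range (K + 1), (1 - partialSum p k) / 2 *
        (u ^ (2 * (1 - partialSum p k) - 1) * ridge (p k) (q k) u ^ (2 * partialSum q k) -
          u ^ (2 * (1 - partialSum p k) - 1) *
            ridge (p (k + 1)) (q (k + 1)) u ^ (2 * partialSum q k)))
      (Ioo 0 1) := by
    intro u hu
    simp only
    -- The factor q̄_k stays attached to the power of `v`: when q̄_k = 0 the power v ^ (-1) is not
    -- integrable at 0, but the product is zero.
    have hint (k : ℕ) (hk : k ≤ K) (x y : ℝ) : IntervalIntegrable
        (fun v => partialSum q k * v ^ (2 * partialSum q k - 1)) volume x y := by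
      rcases (h.partialSum_right_nonneg hk).eq_or_lt' with h0 | h0
      · simp [h0]
      · exact (intervalIntegral.intervalIntegrable_rpow' (by linarith)).const_mul _
    rw [h.integral_eq_sum_sectors hu
      (g := fun k v => (1 - partialSum p k) * u ^ (2 * (1 - partialSum p k) - 1) *
        (partialSum q k * v ^ (2 * partialSum q k - 1)))
      (fun k hk v hv => ?_) (fun k hk => (hint k hk _ _).const_mul _)]
    · refine Finset.sum_congr rfl fun k hk => ?_
      have hk : k ≤ K := Nat.le_of_lt_succ (Finset.mem_range.1 hk)
      rw [intervalIntegral.integral_const_mul, intervalIntegral.integral_const_mul]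
      rcases (h.partialSum_right_nonneg hk).eq_or_lt' with h0 | h0
      · simp [h0]
      · rw [integral_rpow (Or.inl (by linarith)), sub_add_cancel]
        field_simp
    · have hv0 : 0 < v := (ridge_nonneg hu.1.le).trans_lt hv.1
      have hu0 : 0 < u := hu.1
      simp only
      rw [h.liebscherDeriv_left_of_mem_sector hk hu hv,
        h.liebscherDeriv_right_of_mem_sector hk hu hv, Real.rpow_sub_one hu0.ne',
        Real.rpow_sub_one hv0.ne', two_mul, two_mul, Real.rpow_add hu0, Real.rpow_add hv0]
      ring
  have key (k : ℕ) (ha : 0 < 1 - partialSum p k) (hb : 0 < partialSum q k) (j : ℕ)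
      (hj : j ≤ K + 1) :=
    intervalIntegrable_and_integral_rpow_mul_ridge_rpow (h.left_nonneg j hj) (h.right_nonneg j hj)
      (c := 2 * (1 - partialSum p k) - 1) (d := 2 * partialSum q k)
      (by linarith) (by linarith)
  rw [intervalIntegral.integral_congr_Ioo_of_le zero_le_one inner,
    intervalIntegral.integral_finsetSum, Finset.mul_sum]
  · refine Finset.sum_congr rfl fun k hk => ?_
    have hk : k ≤ K := Nat.le_of_lt_succ (Finset.mem_range.1 hk)
    -- `key` needs both 1 - p̄_k and q̄_k positive; if either is zero, the summands on both sides
    -- vanish.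
    rcases (h.partialSum_right_nonneg hk).eq_or_lt' with hb | hb
    · simp [hb]
    rcases (sub_nonneg.2 (h.partialSum_left_le_one hk)).eq_or_lt' with ha | ha
    · simp [ha]
    have k1 := key k ha hb k (by omega)
    have k2 := key k ha hb (k + 1) (by omega)
    rw [intervalIntegral.integral_const_mul, intervalIntegral.integral_sub k1.1 k2.1, k1.2, k2.2]
    have d1 := h.denom_pos (k := k) (by omega) ha hb
    have d2 := h.denom_pos (k := k + 1) (by omega) ha hb
    have e (j : ℕ) : (2 * (1 - partialSum p k) - 1 + 1) * q j + 2 * partialSum q k * p j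
        = 2 * ((1 - partialSum p k) * q j + partialSum q k * p j) := by ring
    rw [e, e, add_comm (partialSum q k * p k), add_comm (partialSum q k * p (k + 1))]
    generalize 1 - partialSum p k = a at *
    generalize partialSum q k = b at *
    field_simp
    ring
  · intro k hk
    have hk : k ≤ K := Nat.le_of_lt_succ (Finset.mem_range.1 hk)
    rcases (h.partialSum_right_nonneg hk).eq_or_lt' with hb | hb
    · simp [hb]
    rcases (sub_nonneg.2 (h.partialSum_left_le_one hk)).eq_or_lt' with ha | ha
    · simp [ha]
    exact ((key k ha hb k (by omega)).1.sub (key k ha hb (k + 1) (by omega)).1).const_mul _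

end IsSlopeOrdered

/-! ### Closed formulas for τ and ρ. -/

namespace IsSlopeOrdered

variable {K : ℕ} {p q : ℕ → ℝ}

theorem kendallTau_liebscherCL (h : IsSlopeOrdered K p q) :
    kendallTau (liebscherCL K p q) = 1 - ∑ k ∈ Finset.Ico 1 K,
      (1 - partialSum p k) * partialSum q k * (p (k + 1) * q k - p k * q (k + 1)) /
        ((partialSum q k * p k + (1 - partialSum p k) * q k) *
          (partialSum q k * p (k + 1) + (1 - partialSum p k) * q (k + 1))) := by
  have hK := h.one_le
  have hq0 : partialSum q 0 = 0 := by simp [partialSum]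
  have hpK : partialSum p K = 1 := h.sum_left
  rw [kendallTau_liebscherCL_eq_integral
    (fun k hk => h.left_nonneg k (by rw [Finset.mem_Icc] at hk; omega))
    (fun k hk => h.right_nonneg k (by rw [Finset.mem_Icc] at hk; omega)) h.sum_left h.sum_right,
    h.integral_liebscherDeriv_mul, Finset.sum_range_succ, Finset.range_eq_Ico,
    Finset.sum_eq_sum_Ico_succ_bot hK, hq0, hpK]
  simp

theorem spearmanRho_liebscherCL (h : IsSlopeOrdered K p q) :
    spearmanRho (liebscherCL K p q)
      = 12 * (q 1 * q K + p 1 * q K + p 1 * p K) / ((2 * q 1 + p 1) * (q K + 2 * p K)) - 3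
        + 12 * ∑ k ∈ Finset.Ico 1 K, (p (k + 1) * q k - p k * q (k + 1)) /
            (((1 + partialSum q k) * p k + (2 - partialSum p k) * q k) *
              ((1 + partialSum q k) * p (k + 1) + (2 - partialSum p k) * q (k + 1))) := by
  have hK := h.one_le
  have hq0 : partialSum q 0 = 0 := by simp [partialSum]
  have hp0 : partialSum p 0 = 0 := by simp [partialSum]
  have hpK : partialSum p K = 1 := h.sum_left
  have hqK : partialSum q K = 1 := h.sum_right
  rw [spearmanRho_liebscherCL_eq_integral
    (fun k hk => h.left_nonneg k (by rw [Finset.mem_Icc] at hk; omega)) h.sum_left,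
    h.integral_liebscherCL, Finset.sum_range_succ, Finset.range_eq_Ico,
    Finset.sum_eq_sum_Ico_succ_bot hK, hq0, hp0, hpK, hqK, h.left_first, h.right_first,
    h.left_last, h.right_last]
  have d1 := h.denom_pos (k := 1) (by omega) two_pos one_pos
  have d2 := h.denom_pos (k := K) (by omega) one_pos two_pos
  rw [one_mul] at d1 d2
  have e1 : ((1 + 0) * 0 + (2 - 0) * 1) * ((1 + 0) * p (0 + 1) + (2 - 0) * q (0 + 1))
      = 2 * (2 * q 1 + p 1) := by ring
  have e2 : ((1 + 1) * p K + (2 - 1) * q K) * ((1 + 1) * 1 + (2 - 1) * 0)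
      = 2 * (q K + 2 * p K) := by ring
  -- The sectors k = 0 and k = K contribute p_1 / (2 (2 q_1 + p_1)) and q_K / (2 (q_K + 2 p_K));
  -- over a common denominator they form the separate first fraction.
  have : 12 * (q 1 * q K + p 1 * q K + p 1 * p K) / ((2 * q 1 + p 1) * (q K + 2 * p K))
      = 12 * ((p (0 + 1) * 1 - 0 * q (0 + 1)) /
          (((1 + 0) * 0 + (2 - 0) * 1) * ((1 + 0) * p (0 + 1) + (2 - 0) * q (0 + 1)))
        + (1 * q K - p K * 0) /
          (((1 + 1) * p K + (2 - 1) * q K) * ((1 + 1) * 1 + (2 - 1) * 0))) := by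
    rw [e1, e2, zero_add, mul_one, one_mul, zero_mul, mul_zero, sub_zero, sub_zero,
      div_add_div _ _ (mul_pos two_pos d1).ne' (mul_pos two_pos d2).ne', mul_div_assoc',
      div_eq_div_iff (mul_pos d1 d2).ne' (mul_pos (mul_pos two_pos d1) (mul_pos two_pos d2)).ne']
    ring
  rw [this]
  ring

end IsSlopeOrdered

/-! ### Ratios in [0,∞] and padded sequences. -/

/-- Cross-multiplication survives infinite ratios: if `q i = 0` then `p i > 0` and ratio `i` is ∞,
which forces `q j = 0`. The pair (0,0) must be excluded at `i`, since its ratio is 0 by convention.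
-/
theorem mul_le_mul_of_ratio_le {p q : ℕ → ℝ} {i j : ℕ} (hpi : 0 ≤ p i) (hqi : 0 ≤ q i)
    (hi : ¬(p i = 0 ∧ q i = 0)) (hpj : 0 ≤ p j) (hqj : 0 ≤ q j) (h : ratio p q i ≤ ratio p q j) :
    p i * q j ≤ p j * q i := by
  unfold ratio at h
  rcases hqj.eq_or_lt' with hj0 | hj0
  · rw [hj0, mul_zero]
    exact mul_nonneg hpj hqi
  rcases hqi.eq_or_lt' with hi0 | hi0
  · have hp0 : 0 < p i := hpi.lt_of_ne fun h => hi ⟨h.symm, hi0⟩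
    rw [hi0, ENNReal.ofReal_zero, ENNReal.div_zero (ENNReal.ofReal_pos.2 hp0).ne', top_le_iff,
      ← ENNReal.ofReal_div_of_pos hj0] at h
    exact absurd h ENNReal.ofReal_ne_top
  · rw [← ENNReal.ofReal_div_of_pos hj0, ← ENNReal.ofReal_div_of_pos hi0,
      ENNReal.ofReal_le_ofReal_iff (div_nonneg hpj hqj)] at h
    exact (div_le_div_iff₀ hi0 hj0).1 h

/-- Extension of a sequence on `{1, …, K}` by a value `a` before and a value `b` after. -/
noncomputable def padSeq (K : ℕ) (a b : ℝ) (x : ℕ → ℝ) (k : ℕ) : ℝ :=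
  if k = 0 then a else if k ≤ K then x k else b

section padSeq

variable {K : ℕ} {a b : ℝ} {x p q : ℕ → ℝ}

theorem padSeq_of_mem {k : ℕ} (hk : k ∈ Finset.Icc 1 K) : padSeq K a b x k = x k := by
  rw [Finset.mem_Icc] at hk
  rw [padSeq, if_neg (by omega), if_pos hk.2]

theorem padSeq_zero : padSeq K a b x 0 = a := if_pos rfl

theorem padSeq_succ : padSeq K a b x (K + 1) = b := by
  rw [padSeq, if_neg (by omega), if_neg (by omega)]

theorem partialSum_padSeq {k : ℕ} (hk : k ≤ K) :
    partialSum (padSeq K a b x) k = partialSum x k :=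
  Finset.sum_congr rfl fun _ hj => padSeq_of_mem (Finset.Icc_subset_Icc_right hk hj)

theorem liebscherCL_padSeq (a b c d : ℝ) :
    liebscherCL K (padSeq K a b p) (padSeq K c d q) = liebscherCL K p q := by
  ext u v
  exact Finset.prod_congr rfl fun k hk => by rw [padSeq_of_mem hk, padSeq_of_mem hk]

theorem isSlopeOrdered_padSeq (hp : ∀ k ∈ Finset.Icc 1 K, 0 ≤ p k)
    (hq : ∀ k ∈ Finset.Icc 1 K, 0 ≤ q k) (hp1 : ∑ k ∈ Finset.Icc 1 K, p k = 1)
    (hq1 : ∑ k ∈ Finset.Icc 1 K, q k = 1)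
    (hpq : ∀ k ∈ Finset.Icc 1 K, ¬(p k = 0 ∧ q k = 0))
    (hr : MonotoneOn (ratio p q) (Icc 1 K)) :
    IsSlopeOrdered K (padSeq K 0 1 p) (padSeq K 1 0 q) := by
  have cases (k : ℕ) (hk : k ≤ K + 1) : k = 0 ∨ k ∈ Finset.Icc 1 K ∨ k = K + 1 := by
    rw [Finset.mem_Icc]; omega
  have hP : ∀ k ≤ K + 1, 0 ≤ padSeq K 0 1 p k := by
    intro k hk
    rcases cases k hk with rfl | hk | rfl
    · rw [padSeq_zero]
    · rw [padSeq_of_mem hk]; exact hp k hk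
    · rw [padSeq_succ]; exact zero_le_one
  have hQ : ∀ k ≤ K + 1, 0 ≤ padSeq K 1 0 q k := by
    intro k hk
    rcases cases k hk with rfl | hk | rfl
    · rw [padSeq_zero]; exact zero_le_one
    · rw [padSeq_of_mem hk]; exact hq k hk
    · rw [padSeq_succ]
  refine ⟨hP, hQ, fun k hk => ?_, fun i j hij hj => ?_, padSeq_zero, padSeq_zero, padSeq_succ,
    padSeq_succ, (partialSum_padSeq le_rfl).trans hp1, (partialSum_padSeq le_rfl).trans hq1⟩
  · rcases cases k hk with rfl | hk | rfl
    · simp [padSeq_zero]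
    · rw [padSeq_of_mem hk, padSeq_of_mem hk]; exact hpq k hk
    · simp [padSeq_succ]
  · have hnn := mul_nonneg (hP j hj) (hQ i (hij.trans hj))
    rcases cases i (hij.trans hj) with rfl | hi | rfl
    · rw [padSeq_zero, zero_mul]; exact hnn
    · rcases cases j hj with rfl | hj | rfl
      · rw [Finset.mem_Icc] at hi; omega
      · rw [padSeq_of_mem hi, padSeq_of_mem hj, padSeq_of_mem hi, padSeq_of_mem hj]
        exact mul_le_mul_of_ratio_le (hp i hi) (hq i hi) (hpq i hi) (hp j hj) (hq j hj)
          (hr (Finset.mem_Icc.1 hi) (Finset.mem_Icc.1 hj) hij)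
      · rw [padSeq_succ (a := 1), mul_zero]; exact hnn
    · rw [le_antisymm hj hij]

end padSeq

/-- Clearing the denominators of slopes `p / x`, `p' / y` in a quotient of bilinear form. -/
theorem div_slope_eq {p p' x y A B D : ℝ} (hx : x ≠ 0) (hy : y ≠ 0) :
    A * (p' / y - p / x) / ((B * (p / x) + D) * (B * (p' / y) + D))
      = A * (p' * x - p * y) / ((B * p + D * x) * (B * p' + D * y)) := by
  have h1 : A * (p' / y - p / x) = A * (p' * x - p * y) / (x * y) := by field_simp
  have h2 : (B * (p / x) + D) * (B * (p' / y) + D)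
      = (B * p + D * x) * (B * p' + D * y) / (x * y) := by field_simp
  rw [h1, h2, div_div_div_cancel_right₀ (mul_ne_zero hx hy)]

theorem proposition8 (K : ℕ) (p q : ℕ → ℝ)
    (hp : ∀ k ∈ Finset.Icc 1 K, 0 ≤ p k) (hq : ∀ k ∈ Finset.Icc 1 K, 0 ≤ q k)
    (hp1 : ∑ k ∈ Finset.Icc 1 K, p k = 1) (hq1 : ∑ k ∈ Finset.Icc 1 K, q k = 1) :
    IsCopula (liebscherCL K p q) ∧
    blomqvistBeta (liebscherCL K p q)
      = (2 : ℝ) ^ (∑ k ∈ Finset.Icc 1 K, min (p k) (q k)) - 1 ∧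
    ((∀ k ∈ Finset.Icc 1 K, ¬ (p k = 0 ∧ q k = 0)) →
      MonotoneOn (ratio p q) (Set.Icc 1 K) →
      -- the formulas for all ratios `r_k` in `[0,∞]`: numerators and denominators are multiplied
      -- by `q_k q_{k+1}` (by `q_1 q_K` in the first term of `ρ`)
      kendallTau (liebscherCL K p q)
        = 1 - ∑ k ∈ Finset.Ico 1 K,
            (1 - partialSum p k) * partialSum q k * (p (k + 1) * q k - p k * q (k + 1)) /
              ((partialSum q k * p k + (1 - partialSum p k) * q k) *
                (partialSum q k * p (k + 1) + (1 - partialSum p k) * q (k + 1))) ∧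
      spearmanRho (liebscherCL K p q)
        = 12 * (q 1 * q K + p 1 * q K + p 1 * p K) / ((2 * q 1 + p 1) * (q K + 2 * p K)) - 3
          + 12 * ∑ k ∈ Finset.Ico 1 K,
            (p (k + 1) * q k - p k * q (k + 1)) /
              (((1 + partialSum q k) * p k + (2 - partialSum p k) * q k) *
                ((1 + partialSum q k) * p (k + 1) + (2 - partialSum p k) * q (k + 1))) ∧
      -- the formulas in terms of `r_k = p_k / q_k` when all ratios are finite
      ((∀ k ∈ Finset.Icc 1 K, 0 < q k) → ∀ r : ℕ → ℝ, (∀ k, r k = p k / q k) →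
        kendallTau (liebscherCL K p q)
          = 1 - ∑ k ∈ Finset.Ico 1 K,
              (1 - partialSum p k) * partialSum q k * (r (k + 1) - r k) /
                ((partialSum q k * r k + (1 - partialSum p k)) *
                  (partialSum q k * r (k + 1) + (1 - partialSum p k))) ∧
        spearmanRho (liebscherCL K p q)
          = 12 * (1 + r 1 + r 1 * r K) / ((2 + r 1) * (1 + 2 * r K)) - 3
            + 12 * ∑ k ∈ Finset.Ico 1 K,
              (r (k + 1) - r k) /
                (((1 + partialSum q k) * r k + (2 - partialSum p k)) *
                  ((1 + partialSum q k) * r (k + 1) + (2 - partialSum p k))))) := by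
  refine ⟨isCopula_liebscherCL hp hq hp1 hq1, blomqvistBeta_liebscherCL hp1 hq1,
    fun hpq hr => ?_⟩
  have h := isSlopeOrdered_padSeq hp hq hp1 hq1 hpq hr
  have hK := h.one_le
  have mem {k : ℕ} (hk : k ∈ Finset.Ico 1 K) : k ∈ Finset.Icc 1 K ∧ k + 1 ∈ Finset.Icc 1 K := by
    rw [Finset.mem_Ico] at hk
    rw [Finset.mem_Icc, Finset.mem_Icc]
    omega
  have h1 : 1 ∈ Finset.Icc 1 K := Finset.mem_Icc.2 ⟨le_rfl, hK⟩
  have h2 : K ∈ Finset.Icc 1 K := Finset.mem_Icc.2 ⟨hK, le_rfl⟩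
  have tau := h.kendallTau_liebscherCL
  have rho := h.spearmanRho_liebscherCL
  rw [liebscherCL_padSeq, Finset.sum_congr rfl fun k hk => by
    rw [padSeq_of_mem (mem hk).1, padSeq_of_mem (mem hk).1, padSeq_of_mem (mem hk).2,
      padSeq_of_mem (mem hk).2, partialSum_padSeq (Finset.mem_Icc.1 (mem hk).1).2,
      partialSum_padSeq (Finset.mem_Icc.1 (mem hk).1).2]] at tau
  rw [liebscherCL_padSeq, Finset.sum_congr rfl fun k hk => by
    rw [padSeq_of_mem (mem hk).1, padSeq_of_mem (mem hk).1, padSeq_of_mem (mem hk).2,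
      padSeq_of_mem (mem hk).2, partialSum_padSeq (Finset.mem_Icc.1 (mem hk).1).2,
      partialSum_padSeq (Finset.mem_Icc.1 (mem hk).1).2],
    padSeq_of_mem h1, padSeq_of_mem h1, padSeq_of_mem h2, padSeq_of_mem h2] at rho
  refine ⟨tau, rho, fun hq0 r hrk => ⟨?_, ?_⟩⟩
  · rw [tau]
    congr 1
    refine Finset.sum_congr rfl fun k hk => ?_
    rw [hrk, hrk, div_slope_eq (hq0 k (mem hk).1).ne' (hq0 _ (mem hk).2).ne']
  · rw [rho]
    congr 2
    · have x1 := (hq0 1 h1).ne'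
      have xK := (hq0 K h2).ne'
      have e1 : 12 * (1 + r 1 + r 1 * r K)
          = 12 * (q 1 * q K + p 1 * q K + p 1 * p K) / (q 1 * q K) := by
        rw [hrk, hrk]; field_simp
      have e2 : (2 + r 1) * (1 + 2 * r K)
          = (2 * q 1 + p 1) * (q K + 2 * p K) / (q 1 * q K) := by
        rw [hrk, hrk]; field_simp
      rw [e1, e2, div_div_div_cancel_right₀ (mul_ne_zero x1 xK)]
    · refine Finset.sum_congr rfl fun k hk => ?_
      have := div_slope_eq (p := p k) (p' := p (k + 1)) (A := 1) (B := 1 + partialSum q k)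
        (D := 2 - partialSum p k) (hq0 k (mem hk).1).ne' (hq0 _ (mem hk).2).ne'
      rw [one_mul, one_mul] at this
      rw [hrk, hrk, this]
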